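/- **Setting.** Let $G$ be a finite simple graph with vertex set $V$, and let $d\ge 0$. For a configuration $p:V\to\mathbb E^d$ let $f_G(p)=(\|p_i-p_j\|^2)_{\{i,j\}\in E(G)}$, and let $f_{K}$ denote the same function for the complete graph $K$ on $V$. Let $S$ be a subgroup of the orthogonal group $O(\mathbb E^d)$ and $\Phi:S\to\mathrm{Aut}(G)$ a homomorphism. Let $\mathscr P_{(G,S,\Phi)}$ be the linear space of configurations with $x(p_i)=p_{\Phi(x)(i)}$ for all $i\in V$, $x\in S$, and let $\tilde f_G$ be the restriction of $f_G$ to it. A configuration $p\in\mathscr P_{(G,S,\Phi)}$ is an *$S$-regular point of $G$* if $\operatorname{rank} d\tilde f_G(p)=\max\{\operatorname{rank} d\tilde f_G(p'): p'\in\mathscr P_{(G,S,\Phi)}\}$. An *$S$-symmetric finite flex* of $(G,p)$ in $\mathbb E^d$ is an analytic path $x:[0,1]\to(\mathbb E^d)^V$ with $x(0)=p$; $f_G(x(t))=f_G(p)$ and $x(t)\in\mathscr P_{(G,S,\Phi)}$ for all $t\in[0,1]$; and $f_K(x(t))\ne f_K(p)$ for all $t\in(0,1]$. On $\mathbb M^{d+1}=\mathbb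 R^{d+1}$ put $\|a\|_{\mathbb M}^2=a_1^2+\dots+a_d^2-a_{d+1}^2$, and let $\mathbb H^d=\{a:\|a\|_{\mathbb M}^2=-1,\ a_{d+1}>0\}$ be hyperbolic space. For $x\in S$ let $x^*(a,s)=(x(a),s)$ for $a\in\mathbb R^d$, $s\in\mathbb R$, and let $S^*=\{x^*:x\in S\}$. For $a\in\mathbb H^d$ let $\pi(a)=(a_1,\dots,a_d)/a_{d+1}\in\mathbb E^d$, and apply $\pi$ to configurations pointwise. A configuration $q:V\to\mathbb H^d$ *has symmetry $S^*$*, of type $\Psi:S^*\to\mathrm{Aut}(G)$ (a homomorphism), if $y(q_i)=q_{\Psi(y)(i)}$ for all $i\in V$, $y\in S^*$. An *$S^*$-symmetric finite flex* of such a $(G,q)$ in $\mathbb H^d$ is an analytic path $x:[0,1]\to(\mathbb H^d)^V$ with $x(0)=q$ such that, for all $t\in[0,1]$, $x(t)$ has symmetry $S^*$ of type $\Psi$ and $\|x_i(t)-x_j(t)\|_{\mathbb M}^2=\|q_i-q_j\|_{\mathbb M}^2$ for every edge $\{i,j\}$ of $G$ (equivalently, hyperbolic bar lengths are kept), and such that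 for every $t\in(0,1]$ this equality fails for some pair $i,j\in V$. **Theorem (Transfer of finite flexes through coning).** Let $p:V\to\mathbb E^d$ be injective and an $S$-regular point of $G$ (of type $\Phi$), and let $q:V\to\mathbb H^d$ be a configuration that has symmetry $S^*$ (of type $\Psi$) and satisfies $\pi(q)=p$. Then $(G,p)$ has an $S$-symmetric finite flex in $\mathbb E^d$ if and only if $(G,q)$ has an $S^*$-symmetric finite flex in $\mathbb H^d$. -/

import Mathlib

noncomputable section

namespace SymFlex

/-- Euclidean `d`-space. -/
abbrev Euc (d : ℕ) : Type := EuclideanSpace ℝ (Fin d)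

/-- The real vector space underlying Minkowskian `(d+1)`-space; a point `(a₁, …, a_d, a_{d+1})` is
written as the pair of `(a₁, …, a_d)` and `a_{d+1}`. -/
abbrev Mink (d : ℕ) : Type := Euc d × ℝ

/-- A symmetry group in dimension `d`: a subgroup of the orthogonal group. -/
abbrev SymmetryGroup (d : ℕ) : Type := Subgroup (Euc d ≃ₗᵢ[ℝ] Euc d)

/-! ### Frameworks in Euclidean space -/

section Euclidean

variable {V : Type*} {d : ℕ}

/-- The edge function `f_G`, sending a configuration to the squared lengths of its bars. -/
def edgeFunction (G : SimpleGraph V) (p : V → Euc d) : G.edgeSet → ℝ := fun e =>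
  Sym2.lift ⟨fun i j => ‖p i - p j‖ ^ 2, fun i j => by simp only [norm_sub_rev]⟩ e.1

/-- The subspace of configurations `p` with `x (p i) = p (Φ x i)` for all vertices `i` and all
`x ∈ S`, that is, the configurations that are `S`-symmetric of type `Φ`. -/
def symConfig {G : SimpleGraph V} (S : SymmetryGroup d) (Φ : S →* (G ≃g G)) :
    Submodule ℝ (V → Euc d) where
  carrier := {p | ∀ (x : S) (i : V), (x : Euc d ≃ₗᵢ[ℝ] Euc d) (p i) = p (Φ x i)}
  add_mem' := by
    intro a b ha hb x i
    simp only [Pi.add_apply, map_add, ha x i, hb x i]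
  zero_mem' := by
    intro x i
    simp
  smul_mem' := by
    intro c a ha x i
    simp only [Pi.smul_apply, map_smul, ha x i]

/-- The restriction of the edge function to the subspace of symmetric configurations. -/
def symEdgeFunction {G : SimpleGraph V} (S : SymmetryGroup d) (Φ : S →* (G ≃g G))
    (p : symConfig S Φ) : G.edgeSet → ℝ :=
  edgeFunction G (p : V → Euc d)

/-- The rank of the derivative at `p` of the restricted edge function. -/
def symRank {G : SimpleGraph V} (S : SymmetryGroup d) (Φ : S →* (G ≃g G))
    (p : symConfig S Φ) : ℕ :=
  Module.finrank ℝ (LinearMap.range (fderiv ℝ (symEdgeFunction S Φ) p).toLinearMap)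

/-- `p` is an `S`-regular point of `G`: it is a symmetric configuration at which the derivative of
the restricted edge function has the largest rank among all symmetric configurations. -/
def IsSRegular {G : SimpleGraph V} (S : SymmetryGroup d) (Φ : S →* (G ≃g G))
    (p : V → Euc d) : Prop :=
  ∃ hp : p ∈ symConfig S Φ, ∀ p' : symConfig S Φ, symRank S Φ p' ≤ symRank S Φ ⟨p, hp⟩

/-- `x` is a finite motion of `(G, p)`: an analytic path on `[0, 1]` that starts at `p` and keeps
the lengths of all bars. Values of `x` outside `[0, 1]` are irrelevant. -/
def IsFiniteMotion [Fintype V] (G : SimpleGraph V) (p : V → Euc d) (x : ℝ → V → Euc d) : Prop :=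
  AnalyticOn ℝ x (Set.Icc 0 1) ∧ x 0 = p ∧
    ∀ t ∈ Set.Icc (0 : ℝ) 1, edgeFunction G (x t) = edgeFunction G p

/-- `x` is a finite flex of `(G, p)`: a finite motion for which no `x t` with `t ∈ (0, 1]` has the
same distances between all pairs of joints as `p`. -/
def IsFiniteFlex [Fintype V] (G : SimpleGraph V) (p : V → Euc d) (x : ℝ → V → Euc d) : Prop :=
  IsFiniteMotion G p x ∧
    ∀ t ∈ Set.Ioc (0 : ℝ) 1,
      edgeFunction (⊤ : SimpleGraph V) (x t) ≠ edgeFunction (⊤ : SimpleGraph V) p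

/-- `(G, p)` has a finite flex along which the symmetry `S`, of type `Φ`, is preserved. -/
def HasSymFiniteFlex [Fintype V] (G : SimpleGraph V) (S : SymmetryGroup d) (Φ : S →* (G ≃g G))
    (p : V → Euc d) : Prop :=
  ∃ x : ℝ → V → Euc d, IsFiniteFlex G p x ∧ ∀ t ∈ Set.Icc (0 : ℝ) 1, x t ∈ symConfig S Φ

end Euclidean

/-! ### Frameworks in hyperbolic space -/

section Hyperbolic

variable {V : Type*} {d : ℕ}

/-- The Minkowskian quadratic form `a₁² + ⋯ + a_d² - a_{d+1}²`. -/
def minkSq (a : Mink d) : ℝ := ‖a.1‖ ^ 2 - a.2 ^ 2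

/-- Hyperbolic space: the upper sheet of the hyperboloid `a₁² + ⋯ + a_d² - a_{d+1}² = -1`.
For two of its points `a`, `b` at hyperbolic distance `δ` one has
`minkSq (a - b) = 2 * cosh δ - 2`, so that `minkSq (a - b)` and `δ` determine each other. -/
def hyp (d : ℕ) : Set (Mink d) := {a | minkSq a = -1 ∧ 0 < a.2}

/-- Central projection from the origin onto the hyperplane `a_{d+1} = 1`, which is identified with
Euclidean `d`-space. -/
def centralProj (a : Mink d) : Euc d := a.2⁻¹ • a.1

/-- The Minkowskian edge function, sending a configuration to the Minkowskian squared lengths of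
its bars. -/
def minkEdgeFunction (G : SimpleGraph V) (q : V → Mink d) : G.edgeSet → ℝ := fun e =>
  Sym2.lift ⟨fun i j => minkSq (q i - q j), fun i j => by
    simp only [minkSq, Prod.fst_sub, Prod.snd_sub, norm_sub_rev, sub_sq_comm]⟩ e.1

/-- The map `x ↦ x*`, where `x* (a, s) = (x a, s)`; the matrix of `x*` is the block diagonal matrix
with blocks the matrix of `x` and `1`. -/
def starHom (d : ℕ) : (Euc d ≃ₗᵢ[ℝ] Euc d) →* (Mink d ≃ₗ[ℝ] Mink d) where
  toFun x := x.toLinearEquiv.prodCongr (LinearEquiv.refl ℝ ℝ)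
  map_one' := rfl
  map_mul' _ _ := rfl

/-- The group `S* = {x* : x ∈ S}`. -/
def starGroup (S : SymmetryGroup d) : Subgroup (Mink d ≃ₗ[ℝ] Mink d) := S.map (starHom d)

/-- The configuration `q` is symmetric under the group `T` with type `Ψ`:
`y (q i) = q (Ψ y i)` for all vertices `i` and all `y ∈ T`. -/
def MinkSymmetric {G : SimpleGraph V} (T : Subgroup (Mink d ≃ₗ[ℝ] Mink d)) (Ψ : T →* (G ≃g G))
    (q : V → Mink d) : Prop :=
  ∀ (y : T) (i : V), (y : Mink d ≃ₗ[ℝ] Mink d) (q i) = q (Ψ y i)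

/-- `x` is a finite motion of `(G, q)` in hyperbolic space: an analytic path on `[0, 1]` of
configurations in hyperbolic space that starts at `q` and keeps the lengths of all bars. -/
def IsHypFiniteMotion [Fintype V] (G : SimpleGraph V) (q : V → Mink d) (x : ℝ → V → Mink d) :
    Prop :=
  AnalyticOn ℝ x (Set.Icc 0 1) ∧ x 0 = q ∧
    ∀ t ∈ Set.Icc (0 : ℝ) 1,
      (∀ i, x t i ∈ hyp d) ∧ minkEdgeFunction G (x t) = minkEdgeFunction G q

/-- `x` is a finite flex of `(G, q)` in hyperbolic space: a finite motion for which no `x t` with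
`t ∈ (0, 1]` has the same distances between all pairs of joints as `q`. -/
def IsHypFiniteFlex [Fintype V] (G : SimpleGraph V) (q : V → Mink d) (x : ℝ → V → Mink d) :
    Prop :=
  IsHypFiniteMotion G q x ∧
    ∀ t ∈ Set.Ioc (0 : ℝ) 1,
      minkEdgeFunction (⊤ : SimpleGraph V) (x t) ≠ minkEdgeFunction (⊤ : SimpleGraph V) q

/-- `(G, q)` has a finite flex in hyperbolic space along which the symmetry `T`, of type `Ψ`, is
preserved. -/
def HasHypSymFiniteFlex [Fintype V] (G : SimpleGraph V) (T : Subgroup (Mink d ≃ₗ[ℝ] Mink d))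
    (Ψ : T →* (G ≃g G)) (q : V → Mink d) : Prop :=
  ∃ x : ℝ → V → Mink d, IsHypFiniteFlex G q x ∧
    ∀ t ∈ Set.Icc (0 : ℝ) 1, MinkSymmetric T Ψ (x t)

end Hyperbolic

end SymFlex

end

noncomputable section

namespace SymFlex

open Filter Topology Module
open scoped ContDiff

section Abstract

variable {E F F' W : Type*} [NormedAddCommGroup E] [NormedSpace ℝ E] [FiniteDimensional ℝ E]
  [NormedAddCommGroup F] [NormedSpace ℝ F] [NormedAddCommGroup F'] [NormedSpace ℝ F']
  [AddCommGroup W] [Module ℝ W] [FiniteDimensional ℝ W]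

/-- The rank of a continuous family of linear maps is lower semicontinuous. -/
theorem eventually_finrank_range_le {X : Type*} [TopologicalSpace X] {h : X → E →L[ℝ] F} {p : X}
    (hh : ContinuousAt h p) :
    ∀ᶠ y in 𝓝 p, finrank ℝ (h p).toLinearMap.range ≤ finrank ℝ (h y).toLinearMap.range := by
  have ho := isOpen_setOfPred_nat_le_rank (𝕜 := ℝ) (E := E) (F := F)
    (finrank ℝ (h p).toLinearMap.range)
  have hm := hh.eventually (ho.mem_nhds (show h p ∈ _ from (finrank_eq_rank ℝ _).le))
  filter_upwards [hm] with y hy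
  have hy' : ((finrank ℝ (h p).toLinearMap.range : ℕ) : Cardinal) ≤ (h y).toLinearMap.rank := hy
  rw [LinearMap.rank, ← finrank_eq_rank] at hy'
  exact_mod_cast hy'

/-- The nullity of a continuous family of linear maps is upper semicontinuous. -/
theorem eventually_finrank_ker_le {X : Type*} [TopologicalSpace X] {h : X → E →L[ℝ] F} {p : X}
    (hh : ContinuousAt h p) :
    ∀ᶠ y in 𝓝 p, finrank ℝ (h y).toLinearMap.ker ≤ finrank ℝ (h p).toLinearMap.ker := by
  filter_upwards [eventually_finrank_range_le hh] with y hy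
  have h1 := (h y).toLinearMap.finrank_range_add_finrank_ker
  have h2 := (h p).toLinearMap.finrank_range_add_finrank_ker
  omega

/-- If the kernel of the derivative at `p` consists of the values at `p` of a continuous family of
kernel vectors, then the same holds at the points near `p`. -/
theorem eventually_ker_le_range {h : E → E →L[ℝ] F} {ξ : E → W →ₗ[ℝ] E} {p : E}
    (hh : ContinuousAt h p) (hξ : ∀ X, ContinuousAt (fun y => ξ y X) p)
    (hker : (h p).toLinearMap.ker ≤ (ξ p).range)
    (hle : ∀ᶠ y in 𝓝 p, (ξ y).range ≤ (h y).toLinearMap.ker) :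
    ∀ᶠ y in 𝓝 p, (h y).toLinearMap.ker ≤ (ξ y).range := by
  set φ := (finBasis ℝ W).equivFun.symm
  set η : E → (Fin (finrank ℝ W) → ℝ) →L[ℝ] E := fun y =>
    LinearMap.toContinuousLinearMap ((ξ y).comp φ.toLinearMap)
  have hη : ContinuousAt η p := continuousAt_clm_apply.2 fun c => hξ (φ c)
  have hrange : ∀ y, (η y).toLinearMap.range = (ξ y).range := fun y => φ.range_comp (ξ y)
  have hrank : ∀ᶠ y in 𝓝 p, finrank ℝ (ξ p).range ≤ finrank ℝ (ξ y).range := by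
    filter_upwards [eventually_finrank_range_le hη] with y hy
    rwa [hrange, hrange] at hy
  filter_upwards [eventually_finrank_ker_le hh, hrank, hle] with y h1 h2 h3
  exact (Submodule.eq_of_le_of_finrank_le h3
    (h1.trans ((Submodule.finrank_mono hker).trans h2))).ge

/-- Infinitesimal rigidity implies rigidity: if the kernel of the derivative of `f` at `p` consists
of the values of vector fields that are annihilated by the derivatives of `f` and `g`, then `g` is
constant along short paths in the fibre of `f` through `p`. -/
theorem exists_eq_of_ker_le_range {f : E → F} {g : E → F'} {ξ : E → W →ₗ[ℝ] E} {p : E}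
    (hf : ContDiffAt ℝ ω f p) (hg : ContDiffAt ℝ ω g p) (hξ : ∀ X, ContinuousAt (fun y => ξ y X) p)
    (hker : (fderiv ℝ f p).toLinearMap.ker ≤ (ξ p).range)
    (hξf : ∀ᶠ y in 𝓝 p, (ξ y).range ≤ (fderiv ℝ f y).toLinearMap.ker)
    (hξg : ∀ᶠ y in 𝓝 p, (ξ y).range ≤ (fderiv ℝ g y).toLinearMap.ker)
    {x : ℝ → E} (hx : DifferentiableOn ℝ x (Set.Icc 0 1)) (hx0 : x 0 = p)
    (hfx : ∀ t ∈ Set.Icc (0 : ℝ) 1, f (x t) = f p) :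
    ∃ t ∈ Set.Ioc (0 : ℝ) 1, g (x t) = g p := by
  have hf1 : ContDiffAt ℝ 1 f p := hf.of_le (by simp)
  have hg1 : ContDiffAt ℝ 1 g p := hg.of_le (by simp)
  have hdf : ∀ᶠ y in 𝓝 p, DifferentiableAt ℝ f y :=
    (hf1.eventually (by simp)).mono fun y hy => hy.differentiableAt (by simp)
  have hdg : ∀ᶠ y in 𝓝 p, DifferentiableAt ℝ g y :=
    (hg1.eventually (by simp)).mono fun y hy => hy.differentiableAt (by simp)
  have hev := (eventually_ker_le_range (hf1.continuousAt_fderiv (by simp)) hξ hker hξf).and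
    (hξg.and (hdf.and hdg))
  have hxc : ContinuousWithinAt x (Set.Icc 0 1) 0 :=
    (hx 0 (by simp)).continuousWithinAt
  rw [ContinuousWithinAt, hx0] at hxc
  obtain ⟨δ, hδ, hball⟩ := Metric.eventually_nhds_iff.1
    (eventually_nhdsWithin_iff.1 (hxc.eventually hev))
  set ε := min 1 (δ / 2) with hε
  have hε0 : 0 < ε := lt_min one_pos (half_pos hδ)
  have hε1 : ε ≤ 1 := min_le_left _ _
  have hεδ : ε < δ := (min_le_right _ _).trans_lt (half_lt_self hδ)
  have hsub : Set.Icc 0 ε ⊆ Set.Icc (0 : ℝ) 1 := Set.Icc_subset_Icc_right hε1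
  have hgood : ∀ t ∈ Set.Icc 0 ε, _ := fun t ht => hball (y := t)
    (by rw [Real.dist_eq, sub_zero, abs_of_nonneg ht.1]; exact ht.2.trans_lt hεδ) (hsub ht)
  have hgx : ∀ t ∈ Set.Icc 0 ε, HasDerivWithinAt (g ∘ x) 0 (Set.Icc 0 ε) t := by
    intro t ht
    obtain ⟨h1, h2, h3, h4⟩ := hgood t ht
    have hxt : HasDerivWithinAt x (derivWithin x (Set.Icc 0 ε) t) (Set.Icc 0 ε) t :=
      ((hx t (hsub ht)).mono hsub).hasDerivWithinAt
    have hft := h3.hasFDerivAt.comp_hasDerivWithinAt t hxt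
    have hgt := h4.hasFDerivAt.comp_hasDerivWithinAt t hxt
    have hft0 : HasDerivWithinAt (f ∘ x) 0 (Set.Icc 0 ε) t :=
      (hasDerivWithinAt_const t _ (f p)).congr (fun s hs => hfx s (hsub hs)) (hfx t (hsub ht))
    have huniq := uniqueDiffOn_Icc hε0 t ht
    have hz : fderiv ℝ f (x t) (derivWithin x (Set.Icc 0 ε) t) = 0 :=
      (huniq.eq_deriv _ hft hft0)
    have hz' : fderiv ℝ g (x t) (derivWithin x (Set.Icc 0 ε) t) = 0 := h2 (h1 hz)
    rwa [hz'] at hgt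
  refine ⟨ε, ⟨hε0, hε1⟩, ?_⟩
  have := constant_of_derivWithin_zero (f := g ∘ x) (a := 0) (b := ε)
    (fun t ht => (hgx t ht).differentiableWithinAt)
    (fun t ht => (hgx t (Set.Ico_subset_Icc_self ht)).derivWithin
      (uniqueDiffOn_Icc hε0 t (Set.Ico_subset_Icc_self ht))) ε ⟨hε0.le, le_rfl⟩
  simpa [hx0] using this

/-- A linear map over a field has a generalized inverse. -/
theorem exists_generalized_inverse {K M N : Type*} [Field K] [AddCommGroup M] [Module K M]
    [AddCommGroup N] [Module K N] (D : M →ₗ[K] N) : ∃ L : N →ₗ[K] M, ∀ v, D (L (D v)) = D v := by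
  obtain ⟨R, hR⟩ := D.rangeRestrict.exists_rightInverse_of_surjective D.range_rangeRestrict
  obtain ⟨L, hL⟩ := R.exists_extend
  refine ⟨L, fun v => ?_⟩
  have h1 : L (D v) = R (D.rangeRestrict v) := LinearMap.congr_fun hL (D.rangeRestrict v)
  rw [h1]
  exact congrArg Subtype.val (LinearMap.congr_fun hR (D.rangeRestrict v))

/-- At a point where the derivative of `f` has locally minimal nullity, every kernel vector is the
velocity of an analytic curve in the fibre of `f`. -/
theorem exists_curve_in_fibre [FiniteDimensional ℝ F] {f : E → F} {p u : E}
    (hf : ContDiffAt ℝ ω f p)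
    (hreg : ∀ᶠ y in 𝓝 p,
      finrank ℝ (fderiv ℝ f p).toLinearMap.ker ≤ finrank ℝ (fderiv ℝ f y).toLinearMap.ker)
    (hu : fderiv ℝ f p u = 0) :
    ∃ γ : ℝ → E, ContDiffAt ℝ ω γ 0 ∧ γ 0 = p ∧ HasDerivAt γ u 0 ∧
      ∀ᶠ t in 𝓝 0, f (γ t) = f p := by
  set D := fderiv ℝ f p with hD
  have hf1 : ContDiffAt ℝ 1 f p := hf.of_le (by simp)
  obtain ⟨L', hL'⟩ := exists_generalized_inverse D.toLinearMap
  set L : F →L[ℝ] E := LinearMap.toContinuousLinearMap L'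
  have hL : ∀ v, D (L (D v)) = D v := hL'
  set φ : E → E := fun y => L (f y) + (y - L (D y)) with hφ
  have hφs : ContDiffAt ℝ ω φ p := by
    refine (L.contDiff.contDiffAt.comp p hf).add (contDiffAt_id.sub ?_)
    exact (L.comp D).contDiff.contDiffAt
  have hφd : HasFDerivAt φ ((ContinuousLinearEquiv.refl ℝ E : E ≃L[ℝ] E) : E →L[ℝ] E) p := by
    have h1 : HasFDerivAt f D p := (hf1.differentiableAt (by simp)).hasFDerivAt
    have h2 := (L.hasFDerivAt.comp p h1).add ((hasFDerivAt_id p).sub (L.comp D).hasFDerivAt)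
    refine h2.congr_fderiv ?_
    ext v
    simp
  have hω : (ω : WithTop ℕ∞) ≠ 0 := by simp
  set ψ := hφs.localInverse hφd hω with hψ
  have hψs : ContDiffAt ℝ ω ψ (φ p) := hφs.to_localInverse hφd hω
  have hψp : ψ (φ p) = p := hφs.localInverse_apply_image hφd hω
  have hψd : HasFDerivAt ψ (ContinuousLinearMap.id ℝ E) (φ p) :=
    (hφs.hasStrictFDerivAt' hφd hω).to_localInverse.hasFDerivAt
  have hψr : ∀ᶠ z in 𝓝 (φ p), φ (ψ z) = z :=
    (hφs.hasStrictFDerivAt' hφd hω).eventually_right_inverse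
  set c : ℝ → E := fun t => φ p + t • u with hc
  have hc0 : c 0 = φ p := by simp [hc]
  have hcs : ContDiff ℝ ω c := contDiff_const.add (contDiff_id.smul contDiff_const)
  have hcd : HasDerivAt c u 0 := by
    have := ((hasDerivAt_id (0 : ℝ)).smul_const u).const_add (φ p)
    rwa [one_smul] at this
  set γ : ℝ → E := fun t => ψ (c t) with hγ
  have hγs : ContDiffAt ℝ ω γ 0 := by
    refine ContDiffAt.comp (0 : ℝ) (g := ψ) (f := c) ?_ hcs.contDiffAt
    rw [hc0]; exact hψs
  have hγ0 : γ 0 = p := by simp only [hγ, hc0, hψp]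
  have hγd : HasDerivAt γ u 0 := by
    have := HasFDerivAt.comp_hasDerivAt (0 : ℝ) (l := ψ) (f := c)
      (l' := ContinuousLinearMap.id ℝ E) (by rw [hc0]; exact hψd) hcd
    exact this
  refine ⟨γ, hγs, hγ0, hγd, ?_⟩
  have hct : Tendsto c (𝓝 0) (𝓝 (φ p)) := by
    have := hcs.continuous.tendsto 0
    rwa [hc0] at this
  have hγt : Tendsto γ (𝓝 0) (𝓝 p) := by
    have := hγs.continuousAt.tendsto
    rwa [hγ0] at this
  have hproj : ∀ᶠ t in 𝓝 (0 : ℝ), D (L (f (γ t))) = D (L (f p)) := by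
    filter_upwards [hct.eventually hψr] with t ht
    have h1 : L (f (γ t)) + (γ t - L (D (γ t))) = L (f p) + (p - L (D p)) + t • u := ht
    have h2 := congrArg D h1
    simpa [hL, hu] using h2
  have hkerP : ∀ᶠ y in 𝓝 p, ((D.comp L).comp (fderiv ℝ f y)).toLinearMap.ker ≤
      (fderiv ℝ f y).toLinearMap.ker := by
    have hcont : ContinuousAt (fun y => (D.comp L).comp (fderiv ℝ f y)) p :=
      continuousAt_const.clm_comp (hf1.continuousAt_fderiv (by simp))
    have hkp : ((D.comp L).comp (fderiv ℝ f p)).toLinearMap.ker = D.toLinearMap.ker := by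
      congr 1
      ext v
      exact hL v
    filter_upwards [eventually_finrank_ker_le hcont, hreg] with y h1 h2
    refine (Submodule.eq_of_le_of_finrank_le ?_ (h1.trans (hkp ▸ h2))).ge
    intro v hv
    have hv' : fderiv ℝ f y v = 0 := hv
    simp [hv']
  have hdf : ∀ᶠ y in 𝓝 p, DifferentiableAt ℝ f y :=
    (hf1.eventually (by simp)).mono fun y hy => hy.differentiableAt (by simp)
  have hdγ : ∀ᶠ t in 𝓝 (0 : ℝ), DifferentiableAt ℝ γ t :=
    ((hγs.of_le (m := 1) (by simp)).eventually (by simp)).mono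
      fun y hy => hy.differentiableAt (by simp)
  have hder : ∀ᶠ t in 𝓝 (0 : ℝ), HasDerivAt (f ∘ γ) 0 t := by
    filter_upwards [hproj.eventually_nhds, hγt.eventually hkerP, hγt.eventually hdf, hdγ]
      with t h1 h2 h3 h4
    have h5 := h3.hasFDerivAt.comp_hasDerivAt t h4.hasDerivAt
    have h6 := (D.comp L).hasFDerivAt.comp_hasDerivAt t h5
    have h7 : HasDerivAt ((D.comp L) ∘ (f ∘ γ)) 0 t :=
      (hasDerivAt_const t (D (L (f p)))).congr_of_eventuallyEq h1
    have h8 : fderiv ℝ f (γ t) (deriv γ t) = 0 := h2 (h6.unique h7)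
    rwa [h8] at h5
  obtain ⟨δ, hδ, hball⟩ := Metric.eventually_nhds_iff_ball.1 hder
  refine Metric.eventually_nhds_iff_ball.2 ⟨δ, hδ, fun t ht => ?_⟩
  have := Metric.isOpen_ball.is_const_of_deriv_eq_zero (convex_ball (0 : ℝ) δ).isPreconnected
    (fun s hs => (hball s hs).differentiableAt.differentiableWithinAt)
    (fun s hs => (hball s hs).deriv) ht (Metric.mem_ball_self hδ)
  simpa [hγ0] using this

/-- At a point where the derivative of `f` has locally minimal nullity, a kernel vector that is not
the velocity of a curve in the fibre of `g` gives a path in the fibre of `f` that leaves the fibre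
of `g`. -/
theorem exists_path_of_curve_velocity [FiniteDimensional ℝ F] [FiniteDimensional ℝ F']
    {f : E → F} {g : E → F'} {p u : E} {U : Set E} (hU : U ∈ 𝓝 p)
    (hf : ContDiffAt ℝ ω f p) (hg : ContDiffAt ℝ ω g p)
    (hreg : ∀ᶠ y in 𝓝 p,
      finrank ℝ (fderiv ℝ f p).toLinearMap.ker ≤ finrank ℝ (fderiv ℝ f y).toLinearMap.ker)
    (hu : fderiv ℝ f p u = 0)
    (hnot : ∀ γ : ℝ → E, γ 0 = p → HasDerivAt γ u 0 → ¬ ∀ᶠ t in 𝓝 0, g (γ t) = g p) :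
    ∃ x : ℝ → E, AnalyticOn ℝ x (Set.Icc 0 1) ∧ x 0 = p ∧
      (∀ t ∈ Set.Icc (0 : ℝ) 1, x t ∈ U ∧ f (x t) = f p) ∧
      ∀ t ∈ Set.Ioc (0 : ℝ) 1, g (x t) ≠ g p := by
  obtain ⟨γ, hγs, hγ0, hγd, hγf⟩ := exists_curve_in_fibre hf hreg hu
  have hga : AnalyticAt ℝ (fun t => g (γ t)) 0 := by
    refine ContDiffAt.analyticAt (ContDiffAt.comp (0 : ℝ) (g := g) (f := γ) ?_ hγs)
    rw [hγ0]; exact hg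
  have hne := (hga.eventually_eq_or_eventually_ne analyticAt_const).resolve_left (hnot γ hγ0 hγd)
  have hγt : Tendsto γ (𝓝 0) (𝓝 p) := by
    have := hγs.continuousAt.tendsto
    rwa [hγ0] at this
  have hall := (eventually_nhdsWithin_iff.1 hne).and
    (hγf.and ((hγt.eventually hU).and (hγs.analyticAt.eventually_analyticAt)))
  obtain ⟨δ, hδ, hball⟩ := Metric.eventually_nhds_iff_ball.1 hall
  have hmem : ∀ t ∈ Set.Icc (0 : ℝ) 1, δ / 2 * t ∈ Metric.ball (0 : ℝ) δ := by
    intro t ht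
    rw [Metric.mem_ball, dist_zero_right, Real.norm_eq_abs, abs_of_nonneg (by have := ht.1; positivity)]
    nlinarith [ht.1, ht.2]
  refine ⟨fun t => γ (δ / 2 * t), fun t ht => ?_, by simp [hγ0], fun t ht => ?_, fun t ht => ?_⟩
  · have hm : AnalyticAt ℝ (fun s : ℝ => δ / 2 * s) t := by fun_prop
    exact ((hball _ (hmem t ht)).2.2.2.comp hm).analyticWithinAt
  · obtain ⟨-, h1, h2, -⟩ := hball _ (hmem t ht)
    exact ⟨h2, h1⟩
  · refine (hball _ (hmem t ⟨ht.1.le, ht.2⟩)).1 ?_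
    have := ht.1
    simp only [Set.mem_compl_iff, Set.mem_singleton_iff]
    positivity

end Abstract

section LinearAlgebra

variable {X ι : Type*} [NormedAddCommGroup X] [InnerProductSpace ℝ X]

/-- A velocity assignment which satisfies the affine dependencies of a point configuration is the
restriction of an affine map. -/
theorem exists_linearMap_sub_eq [Fintype ι] {p w : ι → X} (k : ι)
    (hdep : ∀ c : ι → ℝ, ∑ i, c i = 0 → ∑ i, c i • p i = 0 → ∑ i, c i • w i = 0) :
    ∃ A : X →ₗ[ℝ] X, ∀ i, A (p i - p k) = w i - w k := by
  classical
  set T := Fintype.linearCombination ℝ (fun i => p i - p k)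
  set T' := Fintype.linearCombination ℝ (fun i => w i - w k)
  obtain ⟨R, hR⟩ := exists_generalized_inverse T
  have hexp : ∀ (v : ι → X) (c : ι → ℝ), ∑ i, (c - Pi.single k (∑ j, c j) : ι → ℝ) i • v i =
      Fintype.linearCombination ℝ (fun i => v i - v k) c := by
    intro v c
    simp [Fintype.linearCombination_apply, sub_smul, smul_sub, Finset.sum_sub_distrib,
      Pi.single_apply, Finset.sum_smul]
  have hker : ∀ c, T c = 0 → T' c = 0 := by
    intro c hc
    rw [← hexp] at hc ⊢
    exact hdep _ (by simp [Finset.sum_sub_distrib, Pi.single_apply]) hc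
  refine ⟨T'.comp R, fun i => ?_⟩
  have h1 : T (Pi.single i 1) = p i - p k := by
    simp [T, Fintype.linearCombination_apply, Pi.single_apply]
  have h2 : T' (Pi.single i 1) = w i - w k := by
    simp [T', Fintype.linearCombination_apply, Pi.single_apply]
  have h3 := hker (R (T (Pi.single i 1)) - Pi.single i 1) (by rw [map_sub, hR, sub_self])
  rw [map_sub, sub_eq_zero, h1, h2] at h3
  exact h3

/-- A symmetric velocity assignment that satisfies the affine dependencies of a symmetric point
configuration and infinitesimally preserves all distances comes from an infinitesimal isometry
which commutes with the symmetries. -/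
theorem exists_symmetric_infinitesimal_isometry [FiniteDimensional ℝ X] [Fintype ι] {p w : ι → X}
    (S : Subgroup (X ≃ₗᵢ[ℝ] X)) (σ : S → ι → ι)
    (hp : ∀ (x : S) i, (x : X ≃ₗᵢ[ℝ] X) (p i) = p (σ x i))
    (hw : ∀ (x : S) i, (x : X ≃ₗᵢ[ℝ] X) (w i) = w (σ x i))
    (hdep : ∀ c : ι → ℝ, ∑ i, c i = 0 → ∑ i, c i • p i = 0 → ∑ i, c i • w i = 0)
    (hflex : ∀ i j, inner ℝ (p i - p j) (w i - w j) = 0) :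
    ∃ (A : X →L[ℝ] X) (b : X), (∀ a, inner ℝ (A a) a = 0) ∧
      (∀ (x : S) a, (x : X ≃ₗᵢ[ℝ] X) (A a) = A ((x : X ≃ₗᵢ[ℝ] X) a)) ∧
      (∀ x : S, (x : X ≃ₗᵢ[ℝ] X) b = b) ∧ ∀ i, w i = A (p i) + b := by
  rcases isEmpty_or_nonempty ι with hι | ⟨⟨k⟩⟩
  · exact ⟨0, 0, by simp, by simp, by simp, fun i => isEmptyElim i⟩
  obtain ⟨A₀', hA₀'⟩ := exists_linearMap_sub_eq k hdep
  set A₀ : X →L[ℝ] X := LinearMap.toContinuousLinearMap A₀'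
  have hA₀ : ∀ i, A₀ (p i - p k) = w i - w k := hA₀'
  have hA₀ij : ∀ i j, A₀ (p i - p j) = w i - w j := by
    intro i j
    rw [← sub_sub_sub_cancel_right (p i) (p j) (p k), map_sub, hA₀, hA₀, sub_sub_sub_cancel_right]
  set U := Submodule.span ℝ (Set.range fun i => p i - p k) with hU
  have hmem : ∀ i j, p i - p j ∈ U := by
    intro i j
    rw [← sub_sub_sub_cancel_right (p i) (p j) (p k)]
    exact U.sub_mem (Submodule.subset_span ⟨i, rfl⟩) (Submodule.subset_span ⟨j, rfl⟩)
  have hskew : ∀ u ∈ U, ∀ v ∈ U, inner ℝ (A₀ u) v + inner ℝ u (A₀ v) = 0 := by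
    intro u hu v hv
    induction hu, hv using Submodule.span_induction₂ with
    | mem_mem x y hx hy =>
      obtain ⟨i, rfl⟩ := hx
      obtain ⟨j, rfl⟩ := hy
      simp only [hA₀]
      have h1 := hflex i k
      have h2 := hflex j k
      have h3 := hflex i j
      rw [← sub_sub_sub_cancel_right (p i) (p j) (p k),
        ← sub_sub_sub_cancel_right (w i) (w j) (w k), inner_sub_left,
        inner_sub_right (p i - p k) (w i - w k), inner_sub_right (p j - p k) (w i - w k), h1, h2] at h3
      linarith [real_inner_comm (p j - p k) (w i - w k)]
    | zero_left y hy => simp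
    | zero_right x hx => simp
    | add_left x y z _ _ _ h1 h2 =>
      simp only [map_add, inner_add_left]
      linarith
    | add_right x y z _ _ _ h1 h2 =>
      simp only [map_add, inner_add_right]
      linarith
    | smul_left r x y _ _ h =>
      simp only [map_smul, real_inner_smul_left]
      linear_combination r * h
    | smul_right r x y _ _ h =>
      simp only [map_smul, real_inner_smul_right]
      linear_combination r * h
  have hxU : ∀ (x : S), ∀ u ∈ U, (x : X ≃ₗᵢ[ℝ] X) u ∈ U := by
    intro x u hu
    induction hu using Submodule.span_induction with
    | mem y hy =>
      obtain ⟨i, rfl⟩ := hy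
      simp only [map_sub, hp]
      exact hmem _ _
    | zero => simp
    | add y z _ _ h1 h2 => rw [map_add]; exact U.add_mem h1 h2
    | smul r y _ h => rw [map_smul]; exact U.smul_mem r h
  have hxA : ∀ (x : S), ∀ u ∈ U, (x : X ≃ₗᵢ[ℝ] X) (A₀ u) = A₀ ((x : X ≃ₗᵢ[ℝ] X) u) := by
    intro x u hu
    induction hu using Submodule.span_induction with
    | mem y hy =>
      obtain ⟨i, rfl⟩ := hy
      simp only [hA₀ij, map_sub, hp, hw]
    | zero => simp
    | add y z _ _ h1 h2 => simp only [map_add, h1, h2]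
    | smul r y _ h => simp only [map_smul, h]
  have hadj : ∀ (x : S) (a v : X), inner ℝ ((x : X ≃ₗᵢ[ℝ] X) a) v =
      inner ℝ a (((x⁻¹ : S) : X ≃ₗᵢ[ℝ] X) v) := by
    intro x a v
    rw [← (x : X ≃ₗᵢ[ℝ] X).inner_map_map a (((x⁻¹ : S) : X ≃ₗᵢ[ℝ] X) v)]
    exact congrArg _ ((x : X ≃ₗᵢ[ℝ] X).apply_symm_apply v).symm
  set π := U.starProjection with hπ
  have hπmem : ∀ a, π a ∈ U := fun a => U.starProjection_apply_mem a
  have hπU : ∀ u ∈ U, π u = u := fun u hu => Submodule.starProjection_eq_self_iff.2 hu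
  have hxπ : ∀ (x : S) a, (x : X ≃ₗᵢ[ℝ] X) (π a) = π ((x : X ≃ₗᵢ[ℝ] X) a) := by
    intro x a
    symm
    refine Submodule.eq_starProjection_of_mem_of_inner_eq_zero (hxU x _ (hπmem a)) fun u hu => ?_
    rw [← map_sub, hadj]
    exact U.starProjection_inner_eq_zero a _ (hxU x⁻¹ u hu)
  set B := A₀.comp π with hB
  have hxB : ∀ (x : S) a, (x : X ≃ₗᵢ[ℝ] X) (B a) = B ((x : X ≃ₗᵢ[ℝ] X) a) := by
    intro x a
    simp only [hB, ContinuousLinearMap.comp_apply, hxA x _ (hπmem a), hxπ]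
  have hxBt : ∀ (x : S) a, (x : X ≃ₗᵢ[ℝ] X) (B.adjoint a) = B.adjoint ((x : X ≃ₗᵢ[ℝ] X) a) := by
    intro x a
    refine ext_inner_right ℝ fun v => ?_
    rw [hadj, ContinuousLinearMap.adjoint_inner_left, ← hxB, ContinuousLinearMap.adjoint_inner_left,
      hadj]
  set A := B - B.adjoint.comp (ContinuousLinearMap.id ℝ X - π) with hA
  have hAapp : ∀ a, A a = B a - B.adjoint (a - π a) := fun a => rfl
  have hAU : ∀ u ∈ U, A u = A₀ u := by
    intro u hu
    simp [hAapp, hB, hπU u hu]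
  have hxAA : ∀ (x : S) a, (x : X ≃ₗᵢ[ℝ] X) (A a) = A ((x : X ≃ₗᵢ[ℝ] X) a) := by
    intro x a
    simp only [hAapp, map_sub, hxB, hxBt, hxπ]
  have hAij : ∀ i j, w i - A (p i) = w j - A (p j) := by
    intro i j
    have := hAU _ (hmem i j)
    rw [hA₀ij, map_sub] at this
    rw [sub_eq_sub_iff_sub_eq_sub]
    exact this.symm
  refine ⟨A, w k - A (p k), fun a => ?_, hxAA, fun x => ?_, fun i => ?_⟩
  · rw [hAapp, inner_sub_left, ContinuousLinearMap.adjoint_inner_left, inner_sub_left,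
      real_inner_comm a, sub_sub_cancel]
    have := hskew _ (hπmem a) _ (hπmem a)
    rw [real_inner_comm] at this
    have h2 : inner ℝ (π a) (A₀ (π a)) = 0 := by linarith
    exact h2
  · rw [map_sub, hw, hxAA, hp]
    exact hAij _ _
  · rw [← hAij i k]
    abel

end LinearAlgebra

section Frameworks

variable {V : Type*} {d : ℕ} {G : SimpleGraph V} {S : SymmetryGroup d}
  {Φ : S →* (G ≃g G)}

/-! ### Calculus of the two edge functions -/

/-- The edge function of a graph `H` on the space of symmetric configurations. -/
def eucEdge (Φ : S →* (G ≃g G)) (H : SimpleGraph V) (p : symConfig S Φ) : H.edgeSet → ℝ :=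
  edgeFunction H (p : V → Euc d)

/-- The factor by which `(a, 1)` has to be scaled to lie on the hyperboloid. -/
def hypScale (a : Euc d) : ℝ := (√(1 - ‖a‖ ^ 2))⁻¹

/-- The point of the hyperboloid over a point of the open unit ball, with respect to the central
projection. -/
def hypLift (a : Euc d) : Mink d := (hypScale a • a, hypScale a)

/-- The Minkowskian edge function of a graph `H` in terms of the central projections of the points
in hyperbolic space. -/
def hypEdge (Φ : S →* (G ≃g G)) (H : SimpleGraph V) (p : symConfig S Φ) : H.edgeSet → ℝ :=
  minkEdgeFunction H fun i => hypLift ((p : V → Euc d) i)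

/-- The symmetric configurations inside the open unit ball. -/
def ballConfig (Φ : S →* (G ≃g G)) : Set (symConfig S Φ) := {p | ∀ i, ‖(p : V → Euc d) i‖ < 1}

theorem isOpen_ballConfig [Finite V] : IsOpen (ballConfig Φ) := by
  have : ballConfig Φ = ⋂ i, {p : symConfig S Φ | ‖(p : V → Euc d) i‖ < 1} := by
    ext p
    simp [ballConfig]
  rw [this]
  refine isOpen_iInter_of_finite fun i => isOpen_lt ?_ continuous_const
  exact ((continuous_apply i).comp continuous_subtype_val).norm

theorem one_sub_norm_sq_pos {a : Euc d} (ha : ‖a‖ < 1) : 0 < 1 - ‖a‖ ^ 2 := by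
  nlinarith [norm_nonneg a]

theorem hypScale_pos {a : Euc d} (ha : ‖a‖ < 1) : 0 < hypScale a :=
  inv_pos.2 (Real.sqrt_pos.2 (one_sub_norm_sq_pos ha))

theorem hypScale_sq_mul {a : Euc d} (ha : ‖a‖ < 1) : hypScale a ^ 2 * (1 - ‖a‖ ^ 2) = 1 := by
  have h := one_sub_norm_sq_pos ha
  rw [hypScale, inv_pow, Real.sq_sqrt h.le, inv_mul_cancel₀ h.ne']

theorem hypLift_mem_hyp {a : Euc d} (ha : ‖a‖ < 1) : hypLift a ∈ hyp d := by
  refine ⟨?_, hypScale_pos ha⟩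
  have h := hypScale_sq_mul ha
  simp only [minkSq, hypLift, norm_smul, mul_pow, Real.norm_eq_abs, sq_abs]
  linarith

theorem centralProj_hypLift {a : Euc d} (ha : ‖a‖ < 1) : centralProj (hypLift a) = a := by
  simp only [centralProj, hypLift, smul_smul]
  rw [inv_mul_cancel₀ (hypScale_pos ha).ne', one_smul]

theorem norm_centralProj_sq {a : Mink d} (ha : a ∈ hyp d) :
    ‖centralProj a‖ ^ 2 = 1 - (a.2⁻¹) ^ 2 := by
  have h2 := ha.2
  have h1 : ‖a.1‖ ^ 2 = a.2 ^ 2 - 1 := by have := ha.1; simp only [minkSq] at this; linarith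
  rw [centralProj, norm_smul, mul_pow, Real.norm_eq_abs, sq_abs, h1]
  field_simp

theorem norm_centralProj_lt_one {a : Mink d} (ha : a ∈ hyp d) : ‖centralProj a‖ < 1 := by
  have h := norm_centralProj_sq ha
  have h2 : 0 < a.2⁻¹ := inv_pos.2 ha.2
  nlinarith [norm_nonneg (centralProj a), sq_nonneg (a.2⁻¹)]

theorem hypLift_centralProj {a : Mink d} (ha : a ∈ hyp d) : hypLift (centralProj a) = a := by
  have h2 : 0 < a.2⁻¹ := inv_pos.2 ha.2
  have hs : hypScale (centralProj a) = a.2 := by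
    rw [hypScale, norm_centralProj_sq ha, sub_sub_cancel, Real.sqrt_sq h2.le, inv_inv]
  refine Prod.ext ?_ hs
  simp only [hypLift, hs]
  rw [centralProj, smul_smul, mul_inv_cancel₀ ha.2.ne', one_smul]

theorem minkSq_hypLift_sub {a b : Euc d} (ha : ‖a‖ < 1) (hb : ‖b‖ < 1) :
    minkSq (hypLift a - hypLift b) =
      -2 + 2 * (hypScale a * hypScale b * (1 - inner ℝ a b)) := by
  have h1 := hypScale_sq_mul ha
  have h2 := hypScale_sq_mul hb
  simp only [minkSq, hypLift, Prod.fst_sub, Prod.snd_sub]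
  rw [@norm_sub_sq_real, norm_smul, norm_smul, mul_pow, mul_pow, Real.norm_eq_abs,
    Real.norm_eq_abs, sq_abs, sq_abs, real_inner_smul_left, real_inner_smul_right]
  linear_combination (-1) * h1 - h2

theorem hasDerivAt_hypScale {a : ℝ → Euc d} {u : Euc d} {t : ℝ} (ha : HasDerivAt a u t)
    (h : ‖a t‖ < 1) :
    HasDerivAt (fun s => hypScale (a s)) (hypScale (a t) ^ 3 * inner ℝ (a t) u) t := by
  have hpos := one_sub_norm_sq_pos h
  have hs := Real.sqrt_pos.2 hpos
  have h1 := ((ha.norm_sq.const_sub 1).sqrt hpos.ne').inv hs.ne'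
  refine h1.congr_deriv ?_
  rw [hypScale]
  field_simp

theorem hasDerivAt_coord [Fintype V] {γ : ℝ → symConfig S Φ} {w : symConfig S Φ} {t : ℝ}
    (h : HasDerivAt γ w t) (i : V) :
    HasDerivAt (fun s => (γ s : V → Euc d) i) ((w : V → Euc d) i) t :=
  ((ContinuousLinearMap.proj i).comp (symConfig S Φ).subtypeL).hasFDerivAt.comp_hasDerivAt t h

theorem contDiff_coord [Fintype V] (i : V) :
    ContDiff ℝ ω fun p : symConfig S Φ => (p : V → Euc d) i :=
  ((ContinuousLinearMap.proj (R := ℝ) (φ := fun _ : V => Euc d) i).comp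
    (symConfig S Φ).subtypeL).contDiff

variable {H : SimpleGraph V} [Fintype H.edgeSet]

theorem contDiffAt_eucEdge [Fintype V] (p : symConfig S Φ) : ContDiffAt ℝ ω (eucEdge Φ H) p := by
  refine contDiffAt_pi.2 ?_
  rintro ⟨e, he⟩
  induction e using Sym2.ind with
  | _ i j => exact (((contDiff_coord i).sub (contDiff_coord j)).norm_sq ℝ).contDiffAt

theorem contDiffAt_hypScale {a : Euc d} (ha : ‖a‖ < 1) : ContDiffAt ℝ ω (hypScale (d := d)) a := by
  have h := one_sub_norm_sq_pos ha
  exact ((contDiffAt_const.sub (contDiff_norm_sq ℝ).contDiffAt).sqrt h.ne').inv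
    (Real.sqrt_pos.2 h).ne'

theorem contDiffAt_hypLift {a : Euc d} (ha : ‖a‖ < 1) : ContDiffAt ℝ ω (hypLift (d := d)) a :=
  ((contDiffAt_hypScale ha).smul contDiffAt_id).prodMk (contDiffAt_hypScale ha)

theorem contDiff_minkSq : ContDiff ℝ ω (minkSq (d := d)) :=
  (contDiff_fst.norm_sq ℝ).sub (contDiff_snd.pow 2)

theorem contDiffAt_hypEdge [Fintype V] {p : symConfig S Φ} (hp : p ∈ ballConfig Φ) :
    ContDiffAt ℝ ω (hypEdge Φ H) p := by
  refine contDiffAt_pi.2 ?_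
  rintro ⟨e, he⟩
  induction e using Sym2.ind with
  | _ i j =>
    have hl : ∀ k, ContDiffAt ℝ ω (fun p : symConfig S Φ => hypLift ((p : V → Euc d) k)) p :=
      fun k => ContDiffAt.comp (g := hypLift)
        (f := fun p : symConfig S Φ => (p : V → Euc d) k) p (contDiffAt_hypLift (hp k))
        (contDiff_coord k).contDiffAt
    exact contDiff_minkSq.contDiffAt.comp p ((hl i).sub (hl j))

theorem hasDerivAt_line [Fintype V] (p w : symConfig S Φ) : HasDerivAt (fun t : ℝ => p + t • w) w 0 := by
  have := ((hasDerivAt_id (0 : ℝ)).smul_const w).const_add p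
  rwa [one_smul] at this

theorem fderiv_apply_eq {ι E : Type*} [Fintype ι] [NormedAddCommGroup E] [NormedSpace ℝ E]
    {f : E → ι → ℝ} {p w : E} {γ : ℝ → E} {c : ℝ} {e : ι} (hf : DifferentiableAt ℝ f p)
    (hγ0 : γ 0 = p) (hγ : HasDerivAt γ w 0) (h : HasDerivAt (fun t => f (γ t) e) c 0) :
    fderiv ℝ f p w e = c := by
  subst hγ0
  exact (hasDerivAt_pi.1 (hf.hasFDerivAt.comp_hasDerivAt 0 hγ) e).unique h

theorem fderiv_eucEdge [Fintype V] (p w : symConfig S Φ) {i j : V} (he : s(i, j) ∈ H.edgeSet) :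
    fderiv ℝ (eucEdge Φ H) p w ⟨s(i, j), he⟩ =
      2 * inner ℝ ((p : V → Euc d) i - (p : V → Euc d) j)
        ((w : V → Euc d) i - (w : V → Euc d) j) := by
  refine fderiv_apply_eq ((contDiffAt_eucEdge p).differentiableAt (by simp)) (by simp)
    (hasDerivAt_line p w) ?_
  have h := ((hasDerivAt_coord (hasDerivAt_line p w) i).sub
    (hasDerivAt_coord (hasDerivAt_line p w) j)).norm_sq
  exact h.congr_deriv (by simp)

/-- The linear map taking infinitesimal motions of a Euclidean framework in the unit ball to those
of the hyperbolic framework, in terms of central projections. -/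
def transferMap (p : symConfig S Φ) : symConfig S Φ →ₗ[ℝ] symConfig S Φ where
  toFun w := ⟨fun i => (w : V → Euc d) i -
    inner ℝ ((w : V → Euc d) i) ((p : V → Euc d) i) • (p : V → Euc d) i, by
      intro x i
      simp only [map_sub, map_smul]
      rw [w.2 x i, p.2 x i, ← p.2 x i, ← w.2 x i, LinearIsometryEquiv.inner_map_map]⟩
  map_add' v w := by
    ext1
    funext i
    simp only [Submodule.coe_add, Pi.add_apply, inner_add_left, add_smul]
    abel
  map_smul' r w := by
    ext1
    funext i
    simp only [Submodule.coe_smul, Pi.smul_apply, real_inner_smul_left, mul_smul, smul_sub,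
      RingHom.id_apply]

theorem transferMap_apply (p w : symConfig S Φ) (i : V) :
    (transferMap p w : V → Euc d) i = (w : V → Euc d) i -
      inner ℝ ((w : V → Euc d) i) ((p : V → Euc d) i) • (p : V → Euc d) i := rfl

theorem inner_transferMap (p w : symConfig S Φ) (i : V) :
    inner ℝ ((p : V → Euc d) i) ((transferMap p w : V → Euc d) i) =
      inner ℝ ((w : V → Euc d) i) ((p : V → Euc d) i) * (1 - ‖(p : V → Euc d) i‖ ^ 2) := by
  rw [transferMap_apply, inner_sub_right, real_inner_smul_right, real_inner_self_eq_norm_sq,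
    real_inner_comm]
  ring

theorem transferMap_injective [Fintype V] {p : symConfig S Φ} (hp : p ∈ ballConfig Φ) :
    Function.Injective (transferMap p) := by
  rw [← LinearMap.ker_eq_bot, LinearMap.ker_eq_bot']
  intro w hw
  ext1
  funext i
  have h1 := inner_transferMap p w i
  have h0 : (transferMap p w : V → Euc d) i = 0 := by rw [hw]; rfl
  rw [h0, inner_zero_right, zero_eq_mul,
    or_iff_left (one_sub_norm_sq_pos (hp i)).ne'] at h1
  rw [transferMap_apply, h1, zero_smul, sub_zero] at h0
  exact h0

theorem transferMap_surjective [Fintype V] {p : symConfig S Φ} (hp : p ∈ ballConfig Φ) :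
    Function.Surjective (transferMap p) :=
  LinearMap.injective_iff_surjective.1 (transferMap_injective hp)

theorem hasDerivAt_hypScale_of_transferMap [Fintype V] {p w : symConfig S Φ} (hp : p ∈ ballConfig Φ)
    {γ : ℝ → symConfig S Φ} (hγ0 : γ 0 = p) (hγ : HasDerivAt γ (transferMap p w) 0) (i : V) :
    HasDerivAt (fun t => hypScale ((γ t : V → Euc d) i)) (hypScale ((p : V → Euc d) i) *
      inner ℝ ((w : V → Euc d) i) ((p : V → Euc d) i)) 0 := by
  subst hγ0
  refine (hasDerivAt_hypScale (hasDerivAt_coord hγ i) (hp i)).congr_deriv ?_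
  rw [inner_transferMap]
  linear_combination (hypScale ((γ 0 : V → Euc d) i) *
    inner ℝ ((w : V → Euc d) i) ((γ 0 : V → Euc d) i)) * hypScale_sq_mul (hp i)

theorem fderiv_hypEdge [Fintype V] {p : symConfig S Φ} (hp : p ∈ ballConfig Φ) (w : symConfig S Φ)
    {i j : V} (he : s(i, j) ∈ H.edgeSet) :
    fderiv ℝ (hypEdge Φ H) p (transferMap p w) ⟨s(i, j), he⟩ =
      hypScale ((p : V → Euc d) i) * hypScale ((p : V → Euc d) j) *
        fderiv ℝ (eucEdge Φ H) p w ⟨s(i, j), he⟩ := by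
  have hl := hasDerivAt_line p (transferMap p w)
  have hl0 : p + (0 : ℝ) • transferMap p w = p := by simp
  refine fderiv_apply_eq ((contDiffAt_hypEdge hp).differentiableAt (by simp)) hl0 hl ?_
  have hev : ∀ᶠ t : ℝ in 𝓝 0, p + t • transferMap p w ∈ ballConfig Φ := by
    refine hl.continuousAt.eventually (isOpen_ballConfig.mem_nhds ?_)
    change p + (0 : ℝ) • transferMap p w ∈ ballConfig Φ
    rw [hl0]
    exact hp
  have hsi := hasDerivAt_hypScale_of_transferMap hp hl0 hl i
  have hsj := hasDerivAt_hypScale_of_transferMap hp hl0 hl j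
  have hin := (hasDerivAt_coord hl i).inner ℝ (hasDerivAt_coord hl j)
  have h := (((hsi.mul hsj).mul (hin.const_sub 1)).const_mul 2).const_add (-2)
  refine HasDerivAt.congr_of_eventuallyEq (h.congr_deriv ?_)
    (hev.mono fun t ht => minkSq_hypLift_sub (ht i) (ht j))
  rw [fderiv_eucEdge, hl0]
  simp only [Pi.mul_apply, hl0, transferMap_apply, inner_sub_left, inner_sub_right,
    real_inner_smul_left, real_inner_smul_right]
  rw [real_inner_comm ((p : V → Euc d) i) ((w : V → Euc d) i),
    real_inner_comm ((p : V → Euc d) j) ((w : V → Euc d) j),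
    real_inner_comm ((p : V → Euc d) j) ((w : V → Euc d) i)]
  ring

theorem transferMap_mem_ker_iff [Fintype V] {p : symConfig S Φ} (hp : p ∈ ballConfig Φ)
    (w : symConfig S Φ) :
    transferMap p w ∈ (fderiv ℝ (hypEdge Φ H) p).toLinearMap.ker ↔
      w ∈ (fderiv ℝ (eucEdge Φ H) p).toLinearMap.ker := by
  have h : ∀ e, ∃ c : ℝ, c ≠ 0 ∧ fderiv ℝ (hypEdge Φ H) p (transferMap p w) e =
      c * fderiv ℝ (eucEdge Φ H) p w e := by
    rintro ⟨e, he⟩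
    induction e using Sym2.ind with
    | _ i j => exact ⟨_, (mul_pos (hypScale_pos (hp i)) (hypScale_pos (hp j))).ne',
        fderiv_hypEdge hp w he⟩
  simp only [LinearMap.mem_ker, ContinuousLinearMap.coe_coe, funext_iff, Pi.zero_apply]
  refine forall_congr' fun e => ?_
  obtain ⟨c, hc, he⟩ := h e
  rw [he, mul_eq_zero, or_iff_right hc]

theorem ker_fderiv_hypEdge [Fintype V] {p : symConfig S Φ} (hp : p ∈ ballConfig Φ) :
    (fderiv ℝ (hypEdge Φ H) p).toLinearMap.ker =
      (fderiv ℝ (eucEdge Φ H) p).toLinearMap.ker.map (transferMap p) := by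
  ext u
  obtain ⟨w, rfl⟩ := transferMap_surjective hp u
  rw [transferMap_mem_ker_iff hp, Submodule.mem_map]
  exact ⟨fun h => ⟨w, h, rfl⟩, fun ⟨w', h, hw⟩ => transferMap_injective hp hw ▸ h⟩

end Frameworks

section TrivialMotions

variable {V : Type*} {d : ℕ} {G : SimpleGraph V} {S : SymmetryGroup d}
  {Φ : S →* (G ≃g G)}

/-- The infinitesimal isometries `a ↦ A a + b` of Euclidean space that commute with the symmetry
group. -/
def infIsometry (S : SymmetryGroup d) : Submodule ℝ ((Euc d →ₗ[ℝ] Euc d) × Euc d) where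
  carrier := {X | (∀ a, inner ℝ (X.1 a) a = 0) ∧
    (∀ (x : S) a, (x : Euc d ≃ₗᵢ[ℝ] Euc d) (X.1 a) = X.1 ((x : Euc d ≃ₗᵢ[ℝ] Euc d) a)) ∧
    ∀ x : S, (x : Euc d ≃ₗᵢ[ℝ] Euc d) X.2 = X.2}
  add_mem' := by
    rintro X Y ⟨h1, h2, h3⟩ ⟨h4, h5, h6⟩
    refine ⟨fun a => ?_, fun x a => ?_, fun x => ?_⟩
    · simp [inner_add_left, h1, h4]
    · simp [h2, h5]
    · simp [h3, h6]
  zero_mem' := by simp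
  smul_mem' := by
    rintro r X ⟨h1, h2, h3⟩
    refine ⟨fun a => ?_, fun x a => ?_, fun x => ?_⟩
    · simp [real_inner_smul_left, h1]
    · simp [h2]
    · simp [h3]

/-- The velocities at a symmetric configuration of the symmetric infinitesimal isometries. -/
def trivialVelocity (p : symConfig S Φ) : infIsometry S →ₗ[ℝ] symConfig S Φ where
  toFun X := ⟨fun i => X.1.1 ((p : V → Euc d) i) + X.1.2, by
    intro x i
    rw [map_add, X.2.2.1, X.2.2.2, p.2]⟩
  map_add' X Y := by
    ext1
    funext i
    simp only [Submodule.coe_add, Prod.fst_add, Prod.snd_add, LinearMap.add_apply, Pi.add_apply]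
    abel
  map_smul' r X := by
    ext1
    funext i
    simp

theorem trivialVelocity_apply (p : symConfig S Φ) (X : infIsometry S) (i : V) :
    (trivialVelocity p X : V → Euc d) i = X.1.1 ((p : V → Euc d) i) + X.1.2 := rfl

theorem continuous_trivialVelocity (X : infIsometry S) :
    Continuous fun p : symConfig S Φ => trivialVelocity p X := by
  refine Continuous.subtype_mk (continuous_pi fun i => ?_) _
  exact (X.1.1.continuous_of_finiteDimensional.comp ((continuous_apply i).comp continuous_subtype_val)).add
    continuous_const

/-- The central projections of the velocities at a symmetric hyperbolic configuration of the
symmetric infinitesimal isometries of hyperbolic space. -/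
def hypTrivialVelocity (p : symConfig S Φ) : infIsometry S →ₗ[ℝ] symConfig S Φ :=
  (transferMap p).comp (trivialVelocity p)

theorem range_hypTrivialVelocity (p : symConfig S Φ) :
    (hypTrivialVelocity p).range =
      (trivialVelocity p).range.map (transferMap p) :=
  LinearMap.range_comp _ _

theorem continuous_hypTrivialVelocity (X : infIsometry S) :
    Continuous fun p : symConfig S Φ => hypTrivialVelocity p X := by
  refine Continuous.subtype_mk (continuous_pi fun i => ?_) _
  have h1 : Continuous fun p : symConfig S Φ => (p : V → Euc d) i :=
    (continuous_apply i).comp continuous_subtype_val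
  have h2 : Continuous fun p : symConfig S Φ => (trivialVelocity p X : V → Euc d) i :=
    (continuous_apply i).comp (continuous_subtype_val.comp (continuous_trivialVelocity X))
  exact h2.sub (Continuous.smul (f := fun p : symConfig S Φ => inner ℝ
    ((trivialVelocity p X : V → Euc d) i) ((p : V → Euc d) i)) (h2.inner h1) h1)

variable {H : SimpleGraph V} [Fintype H.edgeSet]

theorem range_trivialVelocity_le [Fintype V] (p : symConfig S Φ) :
    (trivialVelocity p).range ≤ (fderiv ℝ (eucEdge Φ H) p).toLinearMap.ker := by
  rintro _ ⟨X, rfl⟩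
  rw [LinearMap.mem_ker]
  funext ⟨e, he⟩
  induction e using Sym2.ind with
  | _ i j =>
    refine (fderiv_eucEdge p _ he).trans ?_
    rw [trivialVelocity_apply, trivialVelocity_apply,
      add_sub_add_right_eq_sub, ← map_sub, real_inner_comm, X.2.1, mul_zero, Pi.zero_apply]

theorem range_hypTrivialVelocity_le [Fintype V] {p : symConfig S Φ} (hp : p ∈ ballConfig Φ) :
    (hypTrivialVelocity p).range ≤ (fderiv ℝ (hypEdge Φ H) p).toLinearMap.ker := by
  rw [range_hypTrivialVelocity, ker_fderiv_hypEdge hp]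
  exact Submodule.map_mono (range_trivialVelocity_le p)

/-! ### Velocities of congruent motions are trivial -/

theorem mem_range_trivialVelocity [Fintype V]
    [Fintype (⊤ : SimpleGraph V).edgeSet] {p w : symConfig S Φ}
    (hw : fderiv ℝ (eucEdge Φ (⊤ : SimpleGraph V)) p w = 0)
    (hdep : ∀ c : V → ℝ, ∑ i, c i = 0 → ∑ i, c i • (p : V → Euc d) i = 0 →
      ∑ i, c i • (w : V → Euc d) i = 0) :
    w ∈ (trivialVelocity p).range := by
  have hflex : ∀ i j, inner ℝ ((p : V → Euc d) i - (p : V → Euc d) j)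
      ((w : V → Euc d) i - (w : V → Euc d) j) = 0 := by
    intro i j
    by_cases hij : i = j
    · simp [hij]
    · have he : s(i, j) ∈ (⊤ : SimpleGraph V).edgeSet := hij
      have h := fderiv_eucEdge p w he
      rw [hw, Pi.zero_apply] at h
      linarith
  obtain ⟨A, b, h1, h2, h3, h4⟩ := exists_symmetric_infinitesimal_isometry S (fun x i => Φ x i)
    p.2 w.2 hdep hflex
  refine ⟨⟨(A.toLinearMap, b), h1, h2, h3⟩, ?_⟩
  ext1
  funext i
  exact (h4 i).symm

theorem sum_smul_eq_zero_of_norm_sub_eq {ι X : Type*} [Fintype ι] [NormedAddCommGroup X]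
    [InnerProductSpace ℝ X] {p p' : ι → X} (h : ∀ i j, ‖p' i - p' j‖ = ‖p i - p j‖) {c : ι → ℝ}
    (hc : ∑ i, c i = 0) (hp : ∑ i, c i • p i = 0) : ∑ i, c i • p' i = 0 := by
  rw [← inner_self_eq_zero (𝕜 := ℝ), inner_sum_smul_sum_smul_of_sum_eq_zero _ hc _ hc]
  simp only [h]
  rw [← inner_sum_smul_sum_smul_of_sum_eq_zero _ hc _ hc, hp, inner_zero_left]

theorem edgeFunction_top_eq_iff {p p' : V → Euc d} :
    edgeFunction (⊤ : SimpleGraph V) p' = edgeFunction ⊤ p ↔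
      ∀ i j, ‖p' i - p' j‖ = ‖p i - p j‖ := by
  refine ⟨fun h i j => ?_, fun h => ?_⟩
  · by_cases hij : i = j
    · simp [hij]
    · have he : s(i, j) ∈ (⊤ : SimpleGraph V).edgeSet := hij
      have h1 : ‖p' i - p' j‖ ^ 2 = ‖p i - p j‖ ^ 2 := congrFun h ⟨_, he⟩
      exact (sq_eq_sq₀ (norm_nonneg _) (norm_nonneg _)).1 h1
  · funext ⟨e, he⟩
    induction e using Sym2.ind with
    | _ i j =>
      change ‖p' i - p' j‖ ^ 2 = ‖p i - p j‖ ^ 2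
      rw [h]

theorem velocity_mem_range_of_eucEdge_eq [Fintype V]
    [Fintype (⊤ : SimpleGraph V).edgeSet] {p w : symConfig S Φ} {γ : ℝ → symConfig S Φ}
    (hγ0 : γ 0 = p) (hγ : HasDerivAt γ w 0)
    (h : ∀ᶠ t in 𝓝 0, eucEdge Φ (⊤ : SimpleGraph V) (γ t) = eucEdge Φ ⊤ p) :
    w ∈ (trivialVelocity p).range := by
  subst hγ0
  refine mem_range_trivialVelocity ?_ fun c hc hp => ?_
  · have h1 := ((contDiffAt_eucEdge (H := (⊤ : SimpleGraph V)) (γ 0)).differentiableAt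
      (by simp)).hasFDerivAt.comp_hasDerivAt 0 hγ
    exact h1.unique ((hasDerivAt_const (0 : ℝ) _).congr_of_eventuallyEq h)
  · have h1 : HasDerivAt (fun t => ∑ i, c i • (γ t : V → Euc d) i)
        (∑ i, c i • (w : V → Euc d) i) 0 :=
      HasDerivAt.fun_sum fun i _ => (hasDerivAt_coord hγ i).const_smul (c i)
    refine h1.unique ((hasDerivAt_const (0 : ℝ) (0 : Euc d)).congr_of_eventuallyEq ?_)
    filter_upwards [h] with t ht
    exact sum_smul_eq_zero_of_norm_sub_eq (edgeFunction_top_eq_iff.1 ht) hc hp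

/-- The Minkowskian bilinear form. -/
def minkInner (a b : Mink d) : ℝ := inner ℝ a.1 b.1 - a.2 * b.2

theorem minkSq_sub (a b : Mink d) : minkSq (a - b) = minkSq a + minkSq b - 2 * minkInner a b := by
  simp only [minkSq, minkInner, Prod.fst_sub, Prod.snd_sub, @norm_sub_sq_real]
  ring

theorem minkInner_comm (a b : Mink d) : minkInner a b = minkInner b a := by
  simp only [minkInner, real_inner_comm, mul_comm]

theorem minkInner_sum_smul {ι : Type*} [Fintype ι] (c : ι → ℝ) (g : ι → Mink d) (b : Mink d) :
    minkInner (∑ i, c i • g i) b = ∑ i, c i * minkInner (g i) b := by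
  simp [minkInner, Prod.fst_sum, Prod.snd_sum, sum_inner, real_inner_smul_left, Finset.sum_mul,
    ← Finset.sum_sub_distrib, mul_sub, mul_assoc]

/-- The form is positive definite on the orthogonal complement of a point of hyperbolic space. -/
theorem eq_zero_of_minkInner_eq_zero {z g : Mink d} (hg : minkSq g = -1) (hz : minkInner z z = 0)
    (hzg : minkInner z g = 0) : z = 0 := by
  simp only [minkSq, minkInner, real_inner_self_eq_norm_sq] at hg hz hzg
  have h1 := abs_real_inner_le_norm z.1 g.1
  have h2 : (inner ℝ z.1 g.1) ^ 2 ≤ (‖z.1‖ * ‖g.1‖) ^ 2 := by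
    rw [← sq_abs]
    exact pow_le_pow_left₀ (abs_nonneg _) h1 2
  have h3 : inner ℝ z.1 g.1 = z.2 * g.2 := by linarith
  have h4 : ‖z.1‖ ^ 2 = z.2 ^ 2 := by linarith
  have h5 : ‖g.1‖ ^ 2 = g.2 ^ 2 - 1 := by linarith
  rw [h3, mul_pow, mul_pow, h4, h5] at h2
  have h6 : z.2 ^ 2 = 0 := le_antisymm (by linarith) (sq_nonneg _)
  rw [h6] at h4
  exact Prod.ext (by simpa using h4) (by simpa using h6)

theorem sum_smul_eq_zero_of_minkSq_sub_eq {ι : Type*} [Fintype ι] {l g : ι → Mink d}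
    (hl : ∀ i, l i ∈ hyp d) (hg : ∀ i, g i ∈ hyp d)
    (h : ∀ i j, minkSq (g i - g j) = minkSq (l i - l j)) {c : ι → ℝ}
    (hc : ∑ i, c i • l i = 0) : ∑ i, c i • g i = 0 := by
  rcases isEmpty_or_nonempty ι with hι | ⟨⟨k⟩⟩
  · simp
  have h1 : ∀ i j, minkInner (g i) (g j) = minkInner (l i) (l j) := by
    intro i j
    have := h i j
    rw [minkSq_sub, minkSq_sub, (hl i).1, (hl j).1, (hg i).1, (hg j).1] at this
    linarith
  have h2 : ∀ j, minkInner (∑ i, c i • g i) (g j) = 0 := by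
    intro j
    rw [minkInner_sum_smul]
    simp only [h1]
    rw [← minkInner_sum_smul, hc]
    simp [minkInner]
  refine eq_zero_of_minkInner_eq_zero (hg k).1 ?_ (h2 k)
  rw [minkInner_sum_smul]
  refine Finset.sum_eq_zero fun i _ => ?_
  rw [minkInner_comm, h2, mul_zero]

theorem minkEdgeFunction_top_eq_iff {q q' : V → Mink d} :
    minkEdgeFunction (⊤ : SimpleGraph V) q' = minkEdgeFunction ⊤ q ↔
      ∀ i j, minkSq (q' i - q' j) = minkSq (q i - q j) := by
  refine ⟨fun h i j => ?_, fun h => ?_⟩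
  · by_cases hij : i = j
    · simp [hij]
    · have he : s(i, j) ∈ (⊤ : SimpleGraph V).edgeSet := hij
      exact congrFun h ⟨_, he⟩
  · funext ⟨e, he⟩
    induction e using Sym2.ind with
    | _ i j => exact h i j

theorem velocity_mem_range_of_hypEdge_eq [Fintype V]
    [Fintype (⊤ : SimpleGraph V).edgeSet] {p u : symConfig S Φ} (hp : p ∈ ballConfig Φ)
    {γ : ℝ → symConfig S Φ} (hγ0 : γ 0 = p) (hγ : HasDerivAt γ u 0)
    (h : ∀ᶠ t in 𝓝 0, hypEdge Φ (⊤ : SimpleGraph V) (γ t) = hypEdge Φ ⊤ p) :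
    u ∈ (hypTrivialVelocity p).range := by
  obtain ⟨w, rfl⟩ := transferMap_surjective hp u
  rw [range_hypTrivialVelocity]
  subst hγ0
  refine Submodule.mem_map_of_mem (mem_range_trivialVelocity ?_ fun c hc hcp => ?_)
  · have h1 := ((contDiffAt_hypEdge (H := (⊤ : SimpleGraph V)) hp).differentiableAt
      (by simp)).hasFDerivAt.comp_hasDerivAt 0 hγ
    exact (transferMap_mem_ker_iff hp w).1
      (h1.unique ((hasDerivAt_const (0 : ℝ) _).congr_of_eventuallyEq h))
  · set s : V → ℝ := fun i => hypScale ((γ 0 : V → Euc d) i) with hs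
    have hs0 : ∀ i, s i ≠ 0 := fun i => (hypScale_pos (hp i)).ne'
    have h1 : HasDerivAt (fun t => ∑ i, (c i * (s i)⁻¹) •
        (hypLift ((γ t : V → Euc d) i)).1) (∑ i, c i • (w : V → Euc d) i) 0 := by
      refine HasDerivAt.fun_sum fun i _ => ?_
      have h2 := ((hasDerivAt_hypScale_of_transferMap hp rfl hγ i).smul
        (hasDerivAt_coord hγ i)).const_smul (c i * (s i)⁻¹)
      refine h2.congr_deriv ?_
      have h3 : hypScale ((γ 0 : V → Euc d) i) = s i := rfl
      rw [transferMap_apply, h3, mul_smul (s i), ← smul_add, sub_add_cancel, smul_smul, mul_assoc,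
        inv_mul_cancel₀ (hs0 i), mul_one]
    have hev : ∀ᶠ t in 𝓝 (0 : ℝ), γ t ∈ ballConfig Φ :=
      hγ.continuousAt.eventually (isOpen_ballConfig.mem_nhds hp)
    refine h1.unique ((hasDerivAt_const (0 : ℝ) (0 : Euc d)).congr_of_eventuallyEq ?_)
    filter_upwards [h, hev] with t ht htb
    have h3 := sum_smul_eq_zero_of_minkSq_sub_eq (fun i => hypLift_mem_hyp (hp i))
      (fun i => hypLift_mem_hyp (htb i)) (minkEdgeFunction_top_eq_iff.1 ht)
      (c := fun i => c i * (s i)⁻¹) (Prod.ext ?_ ?_)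
    · simpa [Prod.fst_sum] using congrArg Prod.fst h3
    · have : ∀ i, (c i * (s i)⁻¹) • (hypLift ((γ 0 : V → Euc d) i)).1 =
          c i • (γ 0 : V → Euc d) i := fun i => by
        change (c i * (s i)⁻¹) • s i • (γ 0 : V → Euc d) i = _
        rw [smul_smul, mul_assoc, inv_mul_cancel₀ (hs0 i), mul_one]
      simpa only [Prod.fst_sum, Prod.smul_fst, this, Prod.fst_zero] using hcp
    · have : ∀ i, (c i * (s i)⁻¹) • (hypLift ((γ 0 : V → Euc d) i)).2 = c i := fun i => by
        change (c i * (s i)⁻¹) * s i = _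
        rw [mul_assoc, inv_mul_cancel₀ (hs0 i), mul_one]
      simpa only [Prod.snd_sum, Prod.smul_snd, this, Prod.snd_zero] using hc

end TrivialMotions

section Flexes

variable {V : Type*} {d : ℕ} {G : SimpleGraph V} {S : SymmetryGroup d}
  {Φ : S →* (G ≃g G)}

theorem exists_projection_symConfig [Fintype V] (Φ : S →* (G ≃g G)) :
    ∃ P : (V → Euc d) →L[ℝ] symConfig S Φ, ∀ p : symConfig S Φ, P p = p := by
  obtain ⟨P, hP⟩ := (symConfig S Φ).subtype.exists_leftInverse_of_injective
    (symConfig S Φ).ker_subtype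
  exact ⟨LinearMap.toContinuousLinearMap P, fun p => LinearMap.congr_fun hP p⟩

theorem finrank_ker_le_of_symRank_le [Fintype V] [Fintype G.edgeSet] {p y : symConfig S Φ}
    (h : symRank S Φ y ≤ symRank S Φ p) :
    finrank ℝ (fderiv ℝ (eucEdge Φ G) p).toLinearMap.ker ≤
      finrank ℝ (fderiv ℝ (eucEdge Φ G) y).toLinearMap.ker := by
  have h1 := (fderiv ℝ (eucEdge Φ G) p).toLinearMap.finrank_range_add_finrank_ker
  have h2 := (fderiv ℝ (eucEdge Φ G) y).toLinearMap.finrank_range_add_finrank_ker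
  have h3 : finrank ℝ (fderiv ℝ (eucEdge Φ G) y).toLinearMap.range ≤
    finrank ℝ (fderiv ℝ (eucEdge Φ G) p).toLinearMap.range := h
  omega

theorem finrank_ker_hypEdge [Fintype V] [Fintype G.edgeSet] {p : symConfig S Φ} (hp : p ∈ ballConfig Φ) :
    finrank ℝ (fderiv ℝ (hypEdge Φ G) p).toLinearMap.ker =
      finrank ℝ (fderiv ℝ (eucEdge Φ G) p).toLinearMap.ker := by
  rw [ker_fderiv_hypEdge hp]
  exact (Submodule.equivMapOfInjective _ (transferMap_injective hp) _).finrank_eq.symm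

/-- At a regular point, a symmetric finite flex exists exactly when there is a nontrivial symmetric
infinitesimal motion. -/
theorem hasSymFiniteFlex_iff [Fintype V] [Fintype G.edgeSet]
    [Fintype (⊤ : SimpleGraph V).edgeSet]
    {p : symConfig S Φ} (hreg : ∀ y : symConfig S Φ, symRank S Φ y ≤ symRank S Φ p) :
    HasSymFiniteFlex G S Φ p ↔
      ¬ (fderiv ℝ (eucEdge Φ G) p).toLinearMap.ker ≤ (trivialVelocity p).range := by
  constructor
  · rintro ⟨x, ⟨⟨hx, hx0, hxG⟩, hxK⟩, hxS⟩ hker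
    obtain ⟨P, hP⟩ := exists_projection_symConfig Φ
    have hPx : ∀ t ∈ Set.Icc (0 : ℝ) 1, (P (x t) : V → Euc d) = x t := fun t ht =>
      congrArg Subtype.val (hP ⟨x t, hxS t ht⟩)
    obtain ⟨t, ht, h⟩ := exists_eq_of_ker_le_range (f := eucEdge Φ G)
      (g := eucEdge Φ (⊤ : SimpleGraph V)) (ξ := trivialVelocity)
      (contDiffAt_eucEdge p) (contDiffAt_eucEdge p)
      (fun X => (continuous_trivialVelocity X).continuousAt) hker
      (.of_forall range_trivialVelocity_le) (.of_forall range_trivialVelocity_le)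
      (x := fun t => P (x t)) (P.differentiable.comp_differentiableOn hx.differentiableOn)
      (by rw [hx0, hP]) fun t ht => by rw [eucEdge, hPx t ht, hxG t ht, eucEdge]
    refine hxK t ht ?_
    rwa [eucEdge, hPx t ⟨ht.1.le, ht.2⟩] at h
  · intro hker
    obtain ⟨u, hu, hnot⟩ := SetLike.not_le_iff_exists.1 hker
    obtain ⟨x, hx, hx0, hxG, hxK⟩ := exists_path_of_curve_velocity (U := Set.univ)
      (f := eucEdge Φ G) (g := eucEdge Φ (⊤ : SimpleGraph V)) univ_mem
      (contDiffAt_eucEdge p) (contDiffAt_eucEdge p)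
      (.of_forall fun y => finrank_ker_le_of_symRank_le (hreg y)) hu
      fun γ hγ0 hγ h => hnot (velocity_mem_range_of_eucEdge_eq hγ0 hγ h)
    refine ⟨fun t => x t, ⟨⟨?_, congrArg Subtype.val hx0, fun t ht => (hxG t ht).2⟩, hxK⟩,
      fun t _ => (x t).2⟩
    exact (symConfig S Φ).subtypeL.comp_analyticOn hx

theorem centralProj_starHom (x : Euc d ≃ₗᵢ[ℝ] Euc d) (a : Mink d) :
    centralProj (starHom d x a) = x (centralProj a) := (x.map_smul _ _).symm

theorem starHom_hypLift (x : Euc d ≃ₗᵢ[ℝ] Euc d) (a : Euc d) :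
    starHom d x (hypLift a) = hypLift (x a) := by
  have h : hypScale (x a) = hypScale a := by rw [hypScale, hypScale, x.norm_map]
  refine Prod.ext ?_ h.symm
  change x (hypScale a • a) = hypScale (x a) • x a
  rw [h, x.map_smul]

variable {Ψ : starGroup S →* (G ≃g G)}

theorem centralProj_mem_symConfig
    (hΨ : ∀ (x : S) i, Ψ ⟨starHom d x, Subgroup.mem_map_of_mem _ x.2⟩ i = Φ x i)
    {q : V → Mink d} (hq : MinkSymmetric (starGroup S) Ψ q) :
    (fun i => centralProj (q i)) ∈ symConfig S Φ := by
  intro x i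
  have h := hq ⟨starHom d x, Subgroup.mem_map_of_mem _ x.2⟩ i
  rw [hΨ] at h
  change (x : Euc d ≃ₗᵢ[ℝ] Euc d) (centralProj (q i)) = centralProj (q (Φ x i))
  rw [← h, ← centralProj_starHom]

theorem minkSymmetric_hypLift
    (hΨ : ∀ (x : S) i, Ψ ⟨starHom d x, Subgroup.mem_map_of_mem _ x.2⟩ i = Φ x i)
    (p : symConfig S Φ) :
    MinkSymmetric (starGroup S) Ψ fun i => hypLift ((p : V → Euc d) i) := by
  rintro ⟨_, x, hx, rfl⟩ i
  have h := hΨ ⟨x, hx⟩ i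
  refine (starHom_hypLift x _).trans ?_
  rw [p.2 ⟨x, hx⟩ i, ← h]

/-- At the lift of a regular point inside the unit ball, a symmetric finite flex in hyperbolic space
exists exactly when there is a nontrivial symmetric infinitesimal motion in Euclidean space. -/
theorem hasHypSymFiniteFlex_iff [Fintype V] [Fintype G.edgeSet]
    [Fintype (⊤ : SimpleGraph V).edgeSet]
    (hΨ : ∀ (x : S) i, Ψ ⟨starHom d x, Subgroup.mem_map_of_mem _ x.2⟩ i = Φ x i)
    {p : symConfig S Φ} (hp : p ∈ ballConfig Φ)
    (hreg : ∀ y : symConfig S Φ, symRank S Φ y ≤ symRank S Φ p) :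
    HasHypSymFiniteFlex G (starGroup S) Ψ (fun i => hypLift ((p : V → Euc d) i)) ↔
      ¬ (fderiv ℝ (eucEdge Φ G) p).toLinearMap.ker ≤ (trivialVelocity p).range := by
  have hball : ballConfig Φ ∈ 𝓝 p := isOpen_ballConfig.mem_nhds hp
  rw [← Submodule.map_le_map_iff_of_injective (transferMap_injective hp), ← ker_fderiv_hypEdge hp,
    ← range_hypTrivialVelocity]
  constructor
  · rintro ⟨x, ⟨⟨hx, hx0, hxG⟩, hxK⟩, hxS⟩ hker
    obtain ⟨P, hP⟩ := exists_projection_symConfig Φ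
    set y : ℝ → symConfig S Φ := fun t => P fun i => centralProj (x t i) with hy
    have hyx : ∀ t ∈ Set.Icc (0 : ℝ) 1, (fun i => hypLift ((y t : V → Euc d) i)) = x t := by
      intro t ht
      have h1 : (y t : V → Euc d) = fun i => centralProj (x t i) :=
        congrArg Subtype.val (hP ⟨_, centralProj_mem_symConfig hΨ (hxS t ht)⟩)
      funext i
      rw [h1, hypLift_centralProj ((hxG t ht).1 i)]
    have hyd : DifferentiableOn ℝ y (Set.Icc 0 1) := by
      refine P.differentiable.comp_differentiableOn (differentiableOn_pi.2 fun i => ?_)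
      have h1 := differentiableOn_pi.1 hx.differentiableOn i
      exact (h1.snd.inv fun t ht => ((hxG t ht).1 i).2.ne').smul h1.fst
    have hy0 : y 0 = p := by
      simp only [hy, hx0, centralProj_hypLift (hp _), hP]
    obtain ⟨t, ht, h⟩ := exists_eq_of_ker_le_range (f := hypEdge Φ G)
      (g := hypEdge Φ (⊤ : SimpleGraph V)) (ξ := hypTrivialVelocity)
      (contDiffAt_hypEdge hp) (contDiffAt_hypEdge hp)
      (fun X => (continuous_hypTrivialVelocity X).continuousAt) hker
      (eventually_of_mem hball fun _ => range_hypTrivialVelocity_le)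
      (eventually_of_mem hball fun _ => range_hypTrivialVelocity_le)
      hyd hy0 fun t ht => by rw [hypEdge, hyx t ht, (hxG t ht).2, hypEdge]
    refine hxK t ht ?_
    rwa [hypEdge, hyx t ⟨ht.1.le, ht.2⟩] at h
  · intro hker
    obtain ⟨u, hu, hnot⟩ := SetLike.not_le_iff_exists.1 hker
    obtain ⟨x, hx, hx0, hxG, hxK⟩ := exists_path_of_curve_velocity
      (f := hypEdge Φ G) (g := hypEdge Φ (⊤ : SimpleGraph V)) hball
      (contDiffAt_hypEdge hp) (contDiffAt_hypEdge hp)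
      (eventually_of_mem hball fun y hy => by
        rw [finrank_ker_hypEdge hp, finrank_ker_hypEdge hy]
        exact finrank_ker_le_of_symRank_le (hreg y)) hu
      fun γ hγ0 hγ h => hnot (velocity_mem_range_of_hypEdge_eq hp hγ0 hγ h)
    refine ⟨fun t i => hypLift ((x t : V → Euc d) i), ⟨⟨?_, by simp only [hx0], fun t ht =>
      ⟨fun i => hypLift_mem_hyp ((hxG t ht).1 i), (hxG t ht).2⟩⟩, hxK⟩,
      fun t _ => minkSymmetric_hypLift hΨ (x t)⟩
    refine AnalyticOn.pi fun i t ht => ?_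
    have h1 : AnalyticWithinAt ℝ (fun s => (x s : V → Euc d) i) (Set.Icc 0 1) t :=
      (contDiff_coord i).contDiffAt.analyticAt.comp_analyticWithinAt (hx t ht)
    exact AnalyticAt.comp_analyticWithinAt (f := fun s => (x s : V → Euc d) i)
      (contDiffAt_hypLift ((hxG t ht).1 i)).analyticAt h1

end Flexes

end SymFlex

end

theorem mainTheorem5 {V : Type*} [Fintype V] {d : ℕ} (G : SimpleGraph V)
    (S : SymFlex.SymmetryGroup d) (Φ : S →* (G ≃g G)) (Ψ : SymFlex.starGroup S →* (G ≃g G))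
    (p : V → SymFlex.Euc d) (hp : Function.Injective p) (hreg : SymFlex.IsSRegular S Φ p)
    (q : V → SymFlex.Mink d) (hq : ∀ i, q i ∈ SymFlex.hyp d)
    (hsym : SymFlex.MinkSymmetric (SymFlex.starGroup S) Ψ q)
    (hproj : ∀ i, SymFlex.centralProj (q i) = p i) :
    SymFlex.HasSymFiniteFlex G S Φ p ↔
      SymFlex.HasHypSymFiniteFlex G (SymFlex.starGroup S) Ψ q := by
  obtain ⟨hpS, hreg⟩ := hreg
  have : Fintype G.edgeSet := Fintype.ofFinite _
  have : Fintype (⊤ : SimpleGraph V).edgeSet := Fintype.ofFinite _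
  have hball : (⟨p, hpS⟩ : SymFlex.symConfig S Φ) ∈ SymFlex.ballConfig Φ := fun i => by
    change ‖p i‖ < 1
    rw [← hproj i]
    exact SymFlex.norm_centralProj_lt_one (hq i)
  have hqp : q = fun i => SymFlex.hypLift (p i) := by
    funext i
    rw [← hproj i, SymFlex.hypLift_centralProj (hq i)]
  have hΨ : ∀ (x : S) i,
      Ψ ⟨SymFlex.starHom d x, Subgroup.mem_map_of_mem _ x.2⟩ i = Φ x i := by
    intro x i
    apply hp
    have h := hsym ⟨SymFlex.starHom d x, Subgroup.mem_map_of_mem _ x.2⟩ i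
    rw [← hpS x i, ← hproj, ← hproj, ← h]
    exact SymFlex.centralProj_starHom _ _
  rw [hqp]
  exact (SymFlex.hasSymFiniteFlex_iff hreg).trans
    (SymFlex.hasHypSymFiniteFlex_iff hΨ hball hreg).symm
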